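/- Let $\mathcal M=(\mathcal S,\mathcal A,P,R,\ell)$ and $\bar{\mathcal M}=(\bar{\mathcal S},\bar{\mathcal A},\bar P,\bar R,\bar\ell)$ be Markov decision processes with standard Borel state and action spaces, labelled by subsets of the same set of atomic propositions, with $R:\mathcal S\times\mathcal A\to[-\tfrac12,\tfrac12]$. Assume that $\bar{\mathcal M}$ is discrete: $\bar{\mathcal S}$ is countable, with the discrete metric $\mathbf 1_{\neq}$. Let $\phi:\mathcal S\to\bar{\mathcal S}$ and $\psi:\mathcal S\times\bar{\mathcal A}\to\mathcal A$ be measurable state and action embeddings such that $\ell(s)=\bar\ell(\phi(s))$ for all $s\in\mathcal S$. Let $\bar\pi$ be a memoryless policy of $\bar{\mathcal M}$ such that $\bar R(\bar s,\cdot)$ is $\bar\pi(\cdot\mid\bar s)$-integrable for every $\bar s$. It induces on $\bar{\mathcal S}$ the Markov chain with transitions $\bar P_{\bar\pi}(\cdot\mid\bar s)=\mathbb E_{\bar a\sim\bar\pi(\cdot\mid\bar s)}\bar P(\cdot\mid\bar s,\bar a)$ and rewards $\bar R_{\bar\pi}(\bar s)=\mathbb E_{\bar a\sim\bar\pi(\cdot\mid\bar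 s)}\bar R(\bar s,\bar a)$, and on $\mathcal S$ the Markov chain with transitions $P_{\bar\pi}(\cdot\mid s)=\mathbb E_{\bar a\sim\bar\pi(\cdot\mid\phi(s))}P(\cdot\mid s,\psi(s,\bar a))$ and rewards $R_{\bar\pi}(s)=\mathbb E_{\bar a\sim\bar\pi(\cdot\mid\phi(s))}R(s,\psi(s,\bar a))$. Let $\xi_{\bar\pi}$ be a stationary distribution of the latter chain, and write $s,\bar a\sim\xi_{\bar\pi}$ for drawing $s\sim\xi_{\bar\pi}$ and then $\bar a\sim\bar\pi(\cdot\mid\phi(s))$. For a distance $d$ let $W_d(\mu,\nu)=\inf_\lambda\mathbb E_{(x,y)\sim\lambda}\,d(x,y)$, the infimum being over the couplings $\lambda$ of $\mu$ and $\nu$. Assume that, for constants $K_R,K_P\ge 0$ and all $\bar s_1,\bar s_2\in\bar{\mathcal S}$, $$|\bar R_{\bar\pi}(\bar s_1)-\bar R_{\bar\pi}(\bar s_2)|\le K_R\mathbf 1_{\neq}(\bar s_1,\bar s_2),\qquad W_{\mathbf 1_{\neq}}\big(\bar P_{\bar\pi}(\cdot\mid\bar s_1),\bar P_{\bar\pi}(\cdot\mid\bar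 s_2)\big)\le K_P\mathbf 1_{\neq}(\bar s_1,\bar s_2).$$ Define the local losses, with values in $[0,\infty]$, $$L_R=\mathbb E_{s,\bar a\sim\xi_{\bar\pi}}\big|R(s,\psi(s,\bar a))-\bar R(\phi(s),\bar a)\big|,\qquad L_P=\mathbb E_{s,\bar a\sim\xi_{\bar\pi}}W_{\mathbf 1_{\neq}}\big(\phi_*P(\cdot\mid s,\psi(s,\bar a)),\bar P(\cdot\mid\phi(s),\bar a)\big),$$ where $\phi_*$ is the push-forward under $\phi$. Let $\gamma\in[0,1)$. On the disjoint union $\mathcal S\uplus\bar{\mathcal S}$ of the two induced chains (whose transitions, rewards and labels are again written $P_{\bar\pi},R_{\bar\pi},\ell$) let $\tilde d^{R}_{\bar\pi}$ and $\tilde d^{\ell}_{\bar\pi}$ be the reward-based and the label-based bisimulation pseudometrics, that is, the unique bounded functions $d$ that satisfy, respectively, $$d(x,y)=(1-\gamma)|R_{\bar\pi}(x)-R_{\bar\pi}(y)|+\gamma W_d\big(P_{\bar\pi}(\cdot\mid x),P_{\bar\pi}(\cdot\mid y)\big),$$ $$d(x,y)=\max\big\{\gamma W_d\big(P_{\bar\pi}(\cdot\mid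 x),P_{\bar\pi}(\cdot\mid y)\big),\ \mathbf 1_{\neq}(\ell(x),\ell(y))\big\}.$$ Then, the first bound under the condition $\gamma K_P<1$, $$\mathbb E_{s\sim\xi_{\bar\pi}}\tilde d^{R}_{\bar\pi}(s,\phi(s))\le L_R+\gamma L_P\frac{K_R}{1-\gamma K_P},\qquad \mathbb E_{s\sim\xi_{\bar\pi}}\tilde d^{\ell}_{\bar\pi}(s,\phi(s))\le\frac{\gamma L_P}{1-\gamma}.$$ (Expectations of non-negative functions, if measurability is in doubt, are read as infima of the integrals of measurable majorants.) -/

import Mathlib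

open MeasureTheory ProbabilityTheory
open scoped ENNReal NNReal

noncomputable section

namespace LatentMDP

/-! ### Expectations and the Wasserstein distance -/

/-- The expectation of a `[0, ∞]`-valued function, as the infimum of the integrals of its measurable
majorants. For a measurable function this is the Lebesgue integral (see
`outerExpectation_eq_lintegral`); it makes sense of an expectation of a pseudometric that is not
known in advance to be measurable. -/
def outerExpectation {Ω : Type*} [MeasurableSpace Ω] (μ : Measure Ω) (f : Ω → ℝ≥0∞) : ℝ≥0∞ :=
  ⨅ (g : Ω → ℝ≥0∞) (_ : Measurable g) (_ : f ≤ g), ∫⁻ x, g x ∂μ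

theorem outerExpectation_eq_lintegral {Ω : Type*} [MeasurableSpace Ω] (μ : Measure Ω)
    {f : Ω → ℝ≥0∞} (hf : Measurable f) : outerExpectation μ f = ∫⁻ x, f x ∂μ :=
  le_antisymm (iInf_le_of_le f (iInf_le_of_le hf (iInf_le_of_le le_rfl le_rfl)))
    (le_iInf fun _ => le_iInf fun _ => le_iInf fun h => lintegral_mono h)

theorem outerExpectation_mono {Ω : Type*} [MeasurableSpace Ω] (μ : Measure Ω)
    {f f' : Ω → ℝ≥0∞} (h : f ≤ f') : outerExpectation μ f ≤ outerExpectation μ f' :=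
  le_iInf fun g => le_iInf fun hg => le_iInf fun hfg =>
    iInf_le_of_le g (iInf_le_of_le hg (iInf_le_of_le (h.trans hfg) le_rfl))

theorem outerExpectation_add_const_le {Ω : Type*} [MeasurableSpace Ω] (μ : Measure Ω)
    [IsProbabilityMeasure μ] (f : Ω → ℝ≥0∞) (c : ℝ≥0∞) :
    outerExpectation μ (fun x => f x + c) ≤ outerExpectation μ f + c := by
  unfold outerExpectation
  simp only [ENNReal.iInf_add]
  refine le_iInf fun g => le_iInf fun hg => le_iInf fun hfg => ?_
  refine iInf_le_of_le (fun x => g x + c) (iInf_le_of_le (hg.add_const c)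
    (iInf_le_of_le (fun x => add_le_add (hfg x) le_rfl) ?_))
  rw [lintegral_add_left hg]
  simp

/-- `lam` is a coupling of `μ` and `ν`. -/
def IsCoupling {X : Type*} [MeasurableSpace X] (lam : Measure (X × X)) (μ ν : Measure X) : Prop :=
  lam.map Prod.fst = μ ∧ lam.map Prod.snd = ν

/-- The Wasserstein distance of `μ` and `ν` for the ground distance `d`. -/
def wasserstein {X : Type*} [MeasurableSpace X] (d : X → X → ℝ≥0∞) (μ ν : Measure X) : ℝ≥0∞ :=
  ⨅ (lam : Measure (X × X)) (_ : IsCoupling lam μ ν), outerExpectation lam fun z => d z.1 z.2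

theorem wasserstein_mono {X : Type*} [MeasurableSpace X] {d d' : X → X → ℝ≥0∞} (h : d ≤ d')
    (μ ν : Measure X) : wasserstein d μ ν ≤ wasserstein d' μ ν :=
  iInf_mono fun lam => iInf_mono fun _ => outerExpectation_mono lam fun z => h z.1 z.2

theorem wasserstein_le_add_const {X : Type*} [MeasurableSpace X] {d d' : X → X → ℝ≥0∞} {c : ℝ≥0∞}
    (h : ∀ x y, d x y ≤ d' x y + c) (μ ν : Measure X) [IsProbabilityMeasure μ] :
    wasserstein d μ ν ≤ wasserstein d' μ ν + c := by
  rw [wasserstein, wasserstein]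
  simp only [ENNReal.iInf_add]
  refine le_iInf fun lam => le_iInf fun hlam => iInf_le_of_le lam (iInf_le_of_le hlam ?_)
  have : IsProbabilityMeasure lam := by
    constructor
    have h1 := congrArg (fun m => m Set.univ) hlam.1
    simpa [Measure.map_apply measurable_fst MeasurableSet.univ] using h1
  exact (outerExpectation_mono lam fun z => h z.1 z.2).trans
    (outerExpectation_add_const_le lam _ c)

open Classical in
/-- The discrete metric, `1` on distinct points and `0` on equal ones. -/
def discreteMetric {X : Type*} (x y : X) : ℝ≥0 := if x = y then 0 else 1

/-! ### Markov chains with rewards and labels, and their bisimulation pseudometrics -/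

/-- A Markov chain on `X` with rewards, whose states are labelled by sets of atomic propositions. -/
structure LabelledChain (X AP : Type*) [MeasurableSpace X] where
  transition : Kernel X X
  reward : X → ℝ
  label : X → Set AP

/-- The disjoint union of two chains. -/
def LabelledChain.sum {X Y AP : Type*} [MeasurableSpace X] [MeasurableSpace Y]
    (C : LabelledChain X AP) (D : LabelledChain Y AP) : LabelledChain (X ⊕ Y) AP where
  transition :=
    { toFun := Sum.elim (C.transition.map Sum.inl) (D.transition.map Sum.inr)
      measurable' := (Kernel.measurable _).sumElim (Kernel.measurable _) }
  reward := Sum.elim C.reward D.reward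
  label := Sum.elim C.label D.label

instance LabelledChain.isMarkovKernel_sum {X Y AP : Type*} [MeasurableSpace X] [MeasurableSpace Y]
    (C : LabelledChain X AP) (D : LabelledChain Y AP) [IsMarkovKernel C.transition]
    [IsMarkovKernel D.transition] : IsMarkovKernel (C.sum D).transition where
  isProbabilityMeasure
    | .inl x => by
      have := Kernel.IsMarkovKernel.map C.transition (measurable_inl (α := X) (β := Y))
      exact inferInstanceAs (IsProbabilityMeasure (C.transition.map Sum.inl x))
    | .inr y => by
      have := Kernel.IsMarkovKernel.map D.transition (measurable_inr (α := X) (β := Y))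
      exact inferInstanceAs (IsProbabilityMeasure (D.transition.map Sum.inr y))

/-- What a bisimulation pseudometric takes into account: rewards, or labels. -/
inductive Feature
  | reward
  | label

open Classical in
/-- The operator on distances whose fixed point is the bisimulation pseudometric:
`Δ(d)(x, y) = (1 - γ) |R(x) - R(y)| 1[φ = R] + max (γ W_d(P(x), P(y))) (1[ℓ(x) ≠ ℓ(y)] 1[φ = ℓ])`. -/
def bisimOp {X AP : Type*} [MeasurableSpace X] (C : LabelledChain X AP) (disc : ℝ) (φ : Feature)
    (d : X → X → ℝ≥0∞) : X → X → ℝ≥0∞ := fun x y =>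
  (match φ with
    | .reward => ENNReal.ofReal ((1 - disc) * |C.reward x - C.reward y|)
    | .label => 0) +
  max (ENNReal.ofReal disc * wasserstein d (C.transition x) (C.transition y))
    (match φ with
      | .reward => 0
      | .label => if C.label x = C.label y then 0 else 1)

theorem bisimOp_mono {X AP : Type*} [MeasurableSpace X] (C : LabelledChain X AP) (disc : ℝ)
    (φ : Feature) : Monotone (bisimOp C disc φ) := fun _ _ h _ _ =>
  add_le_add le_rfl (max_le_max (mul_le_mul_right (wasserstein_mono h _ _) _) le_rfl)

/-- The bisimulation pseudometric: the least fixed point of `Δ`. When rewards are bounded, it is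
bounded (`bisimDist_le`), and it is then the only bounded fixed point (`eq_bisimDist`). -/
def bisimDist {X AP : Type*} [MeasurableSpace X] (C : LabelledChain X AP) (disc : ℝ)
    (φ : Feature) : X → X → ℝ≥0∞ :=
  OrderHom.lfp ⟨bisimOp C disc φ, bisimOp_mono C disc φ⟩

theorem bisimOp_bisimDist {X AP : Type*} [MeasurableSpace X] (C : LabelledChain X AP) (disc : ℝ)
    (φ : Feature) : bisimOp C disc φ (bisimDist C disc φ) = bisimDist C disc φ :=
  OrderHom.map_lfp ⟨bisimOp C disc φ, bisimOp_mono C disc φ⟩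

/-- The bisimulation pseudometric is bounded when rewards are. -/
theorem bisimDist_le {X AP : Type*} [MeasurableSpace X] (C : LabelledChain X AP)
    [IsMarkovKernel C.transition] {disc : ℝ} (hdisc : 0 ≤ disc) (hdisc' : disc < 1) (φ : Feature)
    (B : ℝ) (hB : 1 ≤ B) (hR : ∀ x y, |C.reward x - C.reward y| ≤ B) (x y : X) :
    bisimDist C disc φ x y ≤ ENNReal.ofReal B := by
  refine OrderHom.lfp_le (a := fun _ _ => ENNReal.ofReal B)
    ⟨bisimOp C disc φ, bisimOp_mono C disc φ⟩ (fun x y => ?_) x y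
  have hW : wasserstein (fun _ _ => ENNReal.ofReal B) (C.transition x) (C.transition y) ≤
      ENNReal.ofReal B := by
    refine iInf_le_of_le ((C.transition x).prod (C.transition y))
      (iInf_le_of_le ⟨by simp, by simp⟩ ?_)
    rw [outerExpectation_eq_lintegral _ measurable_const]
    simp
  have hm : ENNReal.ofReal disc * wasserstein (fun _ _ => ENNReal.ofReal B) (C.transition x)
      (C.transition y) ≤ ENNReal.ofReal (disc * B) := by
    rw [ENNReal.ofReal_mul hdisc]
    exact mul_le_mul_right hW _
  cases φ with
  | reward =>
    simp only [OrderHom.coe_mk, bisimOp]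
    refine (add_le_add (ENNReal.ofReal_le_ofReal
      (mul_le_mul_of_nonneg_left (hR x y) (by linarith))) (max_le hm zero_le)).trans ?_
    rw [← ENNReal.ofReal_add (by nlinarith) (by nlinarith)]
    exact ENNReal.ofReal_le_ofReal (by linarith)
  | label =>
    simp only [OrderHom.coe_mk, bisimOp, zero_add]
    refine max_le (hm.trans (ENNReal.ofReal_le_ofReal (by nlinarith))) ?_
    split_ifs
    · exact zero_le
    · simpa using ENNReal.ofReal_le_ofReal hB

/-- A bounded fixed point of `Δ` is the bisimulation pseudometric. -/
theorem eq_bisimDist {X AP : Type*} [MeasurableSpace X] (C : LabelledChain X AP)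
    [IsMarkovKernel C.transition] {disc : ℝ} (hdisc' : disc < 1) (φ : Feature)
    (d : X → X → ℝ≥0∞) (hd : bisimOp C disc φ d = d) (B : ℝ≥0) (hB : ∀ x y, d x y ≤ B) :
    d = bisimDist C disc φ := by
  have key : ∀ n : ℕ, ∀ x y,
      d x y ≤ bisimDist C disc φ x y + ENNReal.ofReal disc ^ n * B := by
    intro n
    induction n with
    | zero => intro x y; simpa using (hB x y).trans le_add_self
    | succ n ih =>
      intro x y
      have hW := wasserstein_le_add_const ih (C.transition x) (C.transition y)
      have hm : ENNReal.ofReal disc * wasserstein d (C.transition x) (C.transition y) ≤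
          ENNReal.ofReal disc *
            wasserstein (bisimDist C disc φ) (C.transition x) (C.transition y) +
          ENNReal.ofReal disc ^ (n + 1) * B := by
        refine (mul_le_mul_right hW _).trans (le_of_eq ?_)
        ring
      rw [← bisimOp_bisimDist]
      conv_lhs => rw [← hd]
      unfold bisimOp
      rw [add_assoc]
      refine add_le_add le_rfl (max_le ?_ ?_)
      · exact hm.trans (add_le_add (le_max_left _ _) le_rfl)
      · exact (le_max_right _ _).trans le_self_add
  refine le_antisymm (fun x y => ?_) (OrderHom.lfp_le_fixed _ hd)
  have h0 : Filter.Tendsto (fun n : ℕ => bisimDist C disc φ x y + ENNReal.ofReal disc ^ n * B)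
      Filter.atTop (nhds (bisimDist C disc φ x y + 0 * B)) := by
    refine Filter.Tendsto.const_add _ (ENNReal.Tendsto.mul_const
      (ENNReal.tendsto_pow_atTop_nhds_zero_of_lt_one ?_) (Or.inr ENNReal.coe_ne_top))
    exact ENNReal.ofReal_lt_one.2 hdisc'
  simpa using ge_of_tendsto' h0 fun n => key n x y

/-! ### Markov decision processes and latent space models -/

/-- A Markov decision process with state space `S`, action space `A` and atomic propositions
`AP`. -/
structure MDP (S A AP : Type*) [MeasurableSpace S] [MeasurableSpace A] where
  transition : Kernel (S × A) S
  isMarkovKernel : IsMarkovKernel transition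
  reward : S × A → ℝ
  measurable_reward : Measurable reward
  label : S → Set AP
  measurableSet_label : ∀ T : Set AP, MeasurableSet {s | label s = T}
  initial : S
  enabled : S → Set A
  enabled_nonempty : ∀ s, (enabled s).Nonempty

variable {S A AP S' A' : Type*} [MeasurableSpace S] [MeasurableSpace A] [MeasurableSpace S']
  [MeasurableSpace A']

/-- A memoryless policy, which chooses enabled actions only. -/
structure Policy (M : MDP S A AP) where
  kernel : Kernel S A
  isMarkovKernel : IsMarkovKernel kernel
  enabled : ∀ s, ∀ᵐ a ∂(kernel s), a ∈ M.enabled s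

/-- The Markov chain induced by choosing an action in state `s` at random from `κ s`, with
transitions `E_{a ∼ κ s} P(· | s, a)` and rewards `E_{a ∼ κ s} R(s, a)`. -/
def MDP.inducedChain (M : MDP S A AP) (κ : Kernel S A) : LabelledChain S AP where
  transition := Kernel.snd (κ ⊗ₖ M.transition)
  reward s := ∫ a, M.reward (s, a) ∂(κ s)
  label := M.label

instance MDP.isMarkovKernel_inducedChain (M : MDP S A AP) (κ : Kernel S A) [IsMarkovKernel κ] :
    IsMarkovKernel (M.inducedChain κ).transition := by
  have := M.isMarkovKernel
  exact inferInstanceAs (IsMarkovKernel (Kernel.snd (κ ⊗ₖ M.transition)))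

/-- A latent space model of `M` with latent MDP `M'`: the embeddings of states and of actions. -/
structure LatentSpaceModel (M : MDP S A AP) (M' : MDP S' A' AP) where
  stateEmb : S → S'
  measurable_stateEmb : Measurable stateEmb
  actionEmb : S × A' → A
  measurable_actionEmb : Measurable actionEmb

namespace LatentSpaceModel

variable {M : MDP S A AP} {M' : MDP S' A' AP} (L : LatentSpaceModel M M') (π : Policy M')

/-- The distribution of the latent action in a state of the original MDP: `s ↦ π(· | φ(s))`. -/
def latentActionKernel : Kernel S A' := π.kernel.comap L.stateEmb L.measurable_stateEmb

/-- The latent policy run in the original MDP: draw `a' ∼ π(· | φ(s))`, execute `ψ(s, a')`. -/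
def actionKernel : Kernel S A := (Kernel.id ×ₖ L.latentActionKernel π).map L.actionEmb

/-- The Markov chain induced by the latent policy in the original MDP. -/
def chain : LabelledChain S AP := M.inducedChain (L.actionKernel π)

/-- The Markov chain induced by the latent policy in the latent MDP. -/
def latentChain (_L : LatentSpaceModel M M') (π : Policy M') : LabelledChain S' AP :=
  M'.inducedChain π.kernel

instance isMarkovKernel_latentActionKernel : IsMarkovKernel (L.latentActionKernel π) := by
  have := π.isMarkovKernel
  exact inferInstanceAs (IsMarkovKernel (π.kernel.comap L.stateEmb L.measurable_stateEmb))

instance isMarkovKernel_actionKernel : IsMarkovKernel (L.actionKernel π) :=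
  Kernel.IsMarkovKernel.map _ L.measurable_actionEmb

instance isMarkovKernel_chain : IsMarkovKernel (L.chain π).transition :=
  M.isMarkovKernel_inducedChain _

instance isMarkovKernel_latentChain : IsMarkovKernel (L.latentChain π).transition := by
  have := π.isMarkovKernel
  exact M'.isMarkovKernel_inducedChain _

/-- The distance `d(s, t)` of states in the disjoint union of the original chain and the latent
one. -/
def dist (disc : ℝ) (φ : Feature) : S ⊕ S' → S ⊕ S' → ℝ≥0∞ :=
  bisimDist ((L.chain π).sum (L.latentChain π)) disc φ

/-- The law of `(s, a')` for `s ∼ ξ` and `a' ∼ π(· | φ(s))`. -/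
def stateActionLaw (ξ : Measure S) : Measure (S × A') := ξ ⊗ₘ L.latentActionKernel π

/-- `L_R = E_{(s, a') ∼ ν} |R(s, ψ(s, a')) - R'(φ(s), a')|`. -/
def localRewardLoss (ν : Measure (S × A')) : ℝ≥0∞ :=
  ∫⁻ p, ENNReal.ofReal |M.reward (p.1, L.actionEmb p) - M'.reward (L.stateEmb p.1, p.2)| ∂ν

/-- `L_P = E_{(s, a') ∼ ν} W(φ P(· | s, ψ(s, a')), P'(· | φ(s), a'))`, with the Wasserstein distance
of the discrete metric on latent states. -/
def localTransitionLoss (ν : Measure (S × A')) : ℝ≥0∞ :=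
  ∫⁻ p, wasserstein (fun x y => (discreteMetric x y : ℝ≥0∞))
    ((M.transition (p.1, L.actionEmb p)).map L.stateEmb)
    (M'.transition (L.stateEmb p.1, p.2)) ∂ν

/-- `ξ` is a stationary distribution of the original MDP under the latent policy. -/
def IsStationary (ξ : Measure S) : Prop :=
  IsProbabilityMeasure ξ ∧ (L.chain π).transition.Invariant ξ

/-- The latent MDP is `⟨K_R, K_P⟩`-Lipschitz under `π`, for the discrete metric on its states. -/
def IsLipschitz (KR KP : ℝ≥0) : Prop :=
  (∀ x y, |(L.latentChain π).reward x - (L.latentChain π).reward y| ≤ KR * discreteMetric x y) ∧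
  ∀ x y, wasserstein (fun x y => (discreteMetric x y : ℝ≥0∞))
    ((L.latentChain π).transition x) ((L.latentChain π).transition y) ≤ KP * discreteMetric x y

end LatentSpaceModel

end LatentMDP

end

noncomputable section

namespace LatentMDP

/-! The bisimulation pseudometric is the least fixed point of a monotone operator `Δ`, hence lies
below every `d` with `Δ d ≤ d`. Such a `d` need not be a pseudometric, so it can be taken infinite
except on pairs of an original state `y` and a latent state `x`, where it is `f y + c 1[φ y ≠ x]`
(`graphDist`).

The inequality `Δ d ≤ d` is then a one-step estimate. A maximal coupling keeps `φ y' = x'` except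
with probability the total variation distance, so the Wasserstein term is at most `∫ f dP(y) + c ·
TV` (`wasserstein_graphDist_le`). If `x = φ y`, only the one-step errors `h` of the latent model
appear, and `f = h + γ P f` suffices; its solution is the discounted sum of `h` along the original
chain (`discountedCost`). If `x ≠ φ y`, the constant `c` must pay for the comparison of `φ y` with
`x`: for rewards this asks for `c = (1 - γ) K_R + γ K_P c`, and for labels `c = 1` is enough.

Under a stationary law each term of the discounted sum has the same mean, so `f` has mean `(1 -
γ)⁻¹` times that of `h`, which the local losses control. Total variation replaces the Wasserstein
distance throughout: it is bounded by it, and as a countable sum it is visibly measurable. -/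

/-- The total variation distance of two probability measures on a countable discrete space. -/
def totalVariation {X : Type*} [MeasurableSpace X] (μ ν : Measure X) : ℝ≥0∞ :=
  ∑' x, (μ {x} - ν {x})

theorem totalVariation_triangle {X : Type*} [MeasurableSpace X] (μ ν ρ : Measure X) :
    totalVariation μ ρ ≤ totalVariation μ ν + totalVariation ν ρ := by
  unfold totalVariation
  rw [← ENNReal.tsum_add]
  exact ENNReal.tsum_le_tsum fun _ => tsub_le_tsub_add_tsub

/-- Covers `c = 0` too: there `c⁻¹ = ∞`, but `ρ` vanishes. -/
theorem inv_smul_smul_of_univ_eq {X : Type*} [MeasurableSpace X] {ρ : Measure X} {c : ℝ≥0∞}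
    (hc : c ≠ ∞) (hρ : ρ Set.univ = c) : c⁻¹ • c • ρ = ρ := by
  rcases eq_or_ne c 0 with h0 | h0
  · rw [h0, Measure.measure_univ_eq_zero] at hρ
    simp [hρ]
  · rw [smul_smul, ENNReal.inv_mul_cancel h0 hc, one_smul]

/-! ### Total variation and maximal couplings -/

section TotalVariation

variable {X : Type*} [MeasurableSpace X] [Countable X] [DiscreteMeasurableSpace X]

theorem totalVariation_le_one (μ ν : Measure X) [IsProbabilityMeasure μ] :
    totalVariation μ ν ≤ 1 := by
  calc totalVariation μ ν ≤ ∑' x, μ {x} := ENNReal.tsum_le_tsum fun _ => tsub_le_self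
    _ = ∑' x, μ (id ⁻¹' {x}) := rfl
    _ = μ Set.univ := by
      rw [← measure_iUnion]
      · congr 1; ext x; simp
      · intro x y hxy
        simpa [Function.onFun] using hxy
      · exact fun _ => .of_discrete
    _ = 1 := measure_univ

/-- In any coupling, the mass of `μ` at `x` not matched by `ν` sits on off-diagonal pairs with first
coordinate `x`. These sets partition the complement of the diagonal. -/
theorem totalVariation_le_wasserstein (μ ν : Measure X) :
    totalVariation μ ν ≤ wasserstein (fun x y => (discreteMetric x y : ℝ≥0∞)) μ ν := by
  refine le_iInf fun lam => le_iInf fun ⟨h1, h2⟩ => ?_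
  have hm : ∀ x : X, MeasurableSet {z : X × X | z.1 = x ∧ z.2 ≠ x} := fun _ => .of_discrete
  have hle : totalVariation μ ν ≤ ∑' x, lam {z : X × X | z.1 = x ∧ z.2 ≠ x} := by
    refine ENNReal.tsum_le_tsum fun x => ?_
    rw [tsub_le_iff_right, ← h1, ← h2, Measure.map_apply measurable_fst (.of_discrete),
      Measure.map_apply measurable_snd (.of_discrete)]
    refine (measure_mono fun z hz => ?_).trans (measure_union_le _ _)
    by_cases hz2 : z.2 = x
    · exact Or.inr hz2
    · exact Or.inl ⟨hz, hz2⟩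
  have hU : ∑' x, lam {z : X × X | z.1 = x ∧ z.2 ≠ x} = lam {z : X × X | z.1 ≠ z.2} := by
    rw [← measure_iUnion _ hm]
    · congr 1
      ext z
      simp [eq_comm]
    · intro x y hxy
      refine Set.disjoint_left.2 fun z hz hz' => hxy ?_
      exact hz.1.symm.trans hz'.1
  rw [hU] at hle
  refine hle.trans (le_iInf fun g => le_iInf fun _ => le_iInf fun hfg => ?_)
  rw [← lintegral_indicator_one (μ := lam) (s := {z : X × X | z.1 ≠ z.2}) .of_discrete]
  refine lintegral_mono fun z => le_trans ?_ (hfg z)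
  by_cases hz : z.1 = z.2 <;> simp [discreteMetric, hz]

/-- A pair of random variables can be coupled so that `φ` of the first one differs from the second
one with probability at most their total variation distance. -/
theorem exists_coupling_le_totalVariation {Y : Type*} [MeasurableSpace Y] {φ : Y → X}
    (hφ : Measurable φ) (μ : Measure Y) (ν : Measure X) [IsProbabilityMeasure μ]
    [IsProbabilityMeasure ν] :
    ∃ lam : Measure (Y × X), lam.map Prod.fst = μ ∧ lam.map Prod.snd = ν ∧
      lam {z | φ z.1 ≠ z.2} ≤ totalVariation (μ.map φ) ν := by
  have hμφ : IsProbabilityMeasure (μ.map φ) := Measure.isProbabilityMeasure_map hφ.aemeasurable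
  set a : X → ℝ≥0∞ := fun t => μ.map φ {t} with ha
  set b : X → ℝ≥0∞ := fun t => ν {t} with hb
  have ha' : ∀ t, a t ≠ ∞ := fun t => measure_ne_top _ _
  have hb' : ∀ t, b t ≠ ∞ := fun t => measure_ne_top _ _
  -- The fractions of `a t` and `b t` that can be matched with each other; both convert to the
  -- common mass `min (a t) (b t)`. Where a denominator vanishes, so does the numerator.
  set g : X → ℝ≥0∞ := fun t => min (a t) (b t) / a t with hg
  set h : X → ℝ≥0∞ := fun t => min (a t) (b t) / b t with hh
  have hg1 : ∀ t, g t ≤ 1 := fun t => ENNReal.div_le_of_le_mul (by simp)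
  have hh1 : ∀ t, h t ≤ 1 := fun t => ENNReal.div_le_of_le_mul (by simp)
  have hga : ∀ t, g t * a t = min (a t) (b t) := fun t =>
    ENNReal.div_mul_cancel' (fun h0 => by simp [h0]) (fun h0 => absurd h0 (ha' t))
  have hhb : ∀ t, h t * b t = min (a t) (b t) := fun t =>
    ENNReal.div_mul_cancel' (fun h0 => by simp [h0]) (fun h0 => absurd h0 (hb' t))
  have mg : Measurable (fun s => g (φ s)) :=
    (Measurable.of_discrete (f := g)).comp hφ
  set μ₁ := μ.withDensity fun s => g (φ s) with hμ₁
  set μ₂ := μ.withDensity fun s => 1 - g (φ s) with hμ₂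
  set ν₁ := ν.withDensity h with hν₁
  set ν₂ := ν.withDensity (fun t => 1 - h t) with hν₂
  have hμ : μ₁ + μ₂ = μ := by
    rw [hμ₁, hμ₂, ← withDensity_add_left mg]
    convert withDensity_one (μ := μ) using 2
    funext s
    exact add_tsub_cancel_of_le (hg1 _)
  have hν : ν₁ + ν₂ = ν := by
    rw [hν₁, hν₂, ← withDensity_add_left Measurable.of_discrete]
    convert withDensity_one (μ := ν) using 2
    funext s
    exact add_tsub_cancel_of_le (hh1 _)
  have fibre : ∀ (k : X → ℝ≥0∞) (t : X), (μ.withDensity fun s => k (φ s)).map φ {t} = k t * a t := by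
    intro k t
    have hpre : MeasurableSet (φ ⁻¹' {t}) := hφ .of_discrete
    rw [Measure.map_apply hφ .of_discrete, withDensity_apply _ hpre,
      setLIntegral_congr_fun (g := fun _ => k t) hpre (fun s hs => by
        have : φ s = t := hs
        simp [this]), setLIntegral_const]
    simp only [ha, Measure.map_apply hφ (.of_discrete : MeasurableSet {t})]
  have hμν : μ₁.map φ = ν₁ := by
    refine Measure.ext_of_singleton fun t => ?_
    rw [fibre g, hga, hν₁, withDensity_apply _ .of_discrete, lintegral_singleton, hhb]
  have hfin₁ : IsFiniteMeasure μ₁ := isFiniteMeasure_of_le μ (hμ ▸ Measure.le_add_right le_rfl)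
  have hfin₂ : IsFiniteMeasure μ₂ := isFiniteMeasure_of_le μ (hμ ▸ Measure.le_add_left le_rfl)
  have hfin₃ : IsFiniteMeasure ν₂ := isFiniteMeasure_of_le ν (hν ▸ Measure.le_add_left le_rfl)
  have hμ₂univ : μ₂ Set.univ = totalVariation (μ.map φ) ν := by
    have : μ₂ Set.univ = μ₂.map φ Set.univ := by
      rw [Measure.map_apply hφ .univ, Set.preimage_univ]
    rw [this, ← Set.iUnion_of_singleton X, measure_iUnion (by
      intro x y hxy
      simpa [Function.onFun] using hxy) (fun _ => .of_discrete), totalVariation]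
    refine tsum_congr fun t => ?_
    rw [hμ₂, fibre (fun t => 1 - g t), ENNReal.sub_mul (fun _ _ => ha' t), one_mul, hga]
    exact tsub_min
  -- The matched parts have equal mass and so do the wholes, hence so do the leftovers.
  have hν₂univ : ν₂ Set.univ = μ₂ Set.univ := by
    have h1 : μ₁ Set.univ + μ₂ Set.univ = ν₁ Set.univ + ν₂ Set.univ := by
      rw [← Measure.add_apply, ← Measure.add_apply, hμ, hν, measure_univ, measure_univ]
    have h2 : ν₁ Set.univ = μ₁ Set.univ := by
      rw [← hμν, Measure.map_apply hφ .univ, Set.preimage_univ]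
    rw [h2] at h1
    exact ((ENNReal.add_right_inj (measure_ne_top μ₁ _)).1 h1).symm
  set c := μ₂ Set.univ with hc
  have hcfin : c ≠ ∞ := measure_ne_top _ _
  have hgraph : Measurable fun s => (s, φ s) := measurable_id.prodMk hφ
  -- Matched mass is placed on the graph of `φ`; the leftovers are coupled independently, rescaled
  -- to their common mass `c`. Only the second part can leave the graph.
  refine ⟨μ₁.map (fun s => (s, φ s)) + c⁻¹ • μ₂.prod ν₂, ?_, ?_, ?_⟩
  · rw [Measure.map_add _ _ measurable_fst, Measure.map_smul, Measure.map_fst_prod,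
      Measure.map_map measurable_fst hgraph, hν₂univ, inv_smul_smul_of_univ_eq hcfin rfl]
    convert hμ
    exact Measure.map_id
  · rw [Measure.map_add _ _ measurable_snd, Measure.map_smul, Measure.map_snd_prod,
      Measure.map_map measurable_snd hgraph, ← hc, inv_smul_smul_of_univ_eq hcfin hν₂univ]
    convert hν
    exact hμν
  · have hset : MeasurableSet {z : Y × X | φ z.1 ≠ z.2} :=
      (measurableSet_eq_fun (hφ.comp measurable_fst) measurable_snd).compl
    rw [Measure.add_apply, Measure.map_apply hgraph hset, Measure.smul_apply, ← hμ₂univ]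
    simp only [Set.preimage_ofPred_eq, ne_eq, not_true_eq_false, Set.ofPred_false, measure_empty,
      zero_add, smul_eq_mul]
    calc c⁻¹ * (μ₂.prod ν₂) {z | ¬φ z.1 = z.2} ≤ c⁻¹ * (μ₂.prod ν₂) Set.univ := by
          gcongr; exact Set.subset_univ _
      _ = c⁻¹ * c * c := by
          rw [← Set.univ_prod_univ, Measure.prod_prod, hν₂univ, mul_assoc]
      _ ≤ 1 * c := by gcongr; exact ENNReal.inv_mul_le_one c
      _ = c := one_mul c

end TotalVariation

/-! ### Transport between the two halves of a disjoint union -/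

theorem outerExpectation_map_le {X Y : Type*} [MeasurableSpace X] [MeasurableSpace Y] {e : X → Y}
    (he : MeasurableEmbedding e) (μ : Measure X) (f : Y → ℝ≥0∞) (hf : Measurable (f ∘ e)) :
    outerExpectation (μ.map e) f ≤ ∫⁻ x, f (e x) ∂μ := by
  -- The value `∞` off the range of `e` makes a measurable majorant whatever `f` does there, at no
  -- cost, since the image measure does not charge that set.
  refine iInf_le_of_le (Function.extend e (f ∘ e) fun _ => ∞) (iInf_le_of_le
    (he.measurable_extend hf measurable_const) (iInf_le_of_le (fun y => ?_) ?_))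
  · by_cases hy : ∃ x, e x = y
    · obtain ⟨x, rfl⟩ := hy
      rw [he.injective.extend_apply]
      rfl
    · rw [Function.extend_apply' _ _ _ hy]
      exact le_top
  · rw [he.lintegral_map]
    exact (lintegral_congr fun x => he.injective.extend_apply _ _ _).le

section Transport

variable {Y X : Type*} [MeasurableSpace Y] [MeasurableSpace X] {φ : Y → X}

open Classical in
/-- The distance on `Y ⊕ X` that is `f y + c 1[φ y ≠ x]` for `y` in `Y` and `x` in `X`, and infinite
for all other pairs. -/
def graphDist (φ : Y → X) (f : Y → ℝ≥0∞) (c : ℝ≥0∞) : Y ⊕ X → Y ⊕ X → ℝ≥0∞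
  | .inl y, .inr x => f y + if φ y = x then 0 else c
  | _, _ => ∞

/-- The maximal coupling, pushed into the disjoint union, charges only pairs `(inl y, inr x)`, so
the infinite values of `graphDist` are never seen. -/
theorem wasserstein_graphDist_le [Countable X] [DiscreteMeasurableSpace X] (hφ : Measurable φ)
    {f : Y → ℝ≥0∞} (hf : Measurable f) (c : ℝ≥0∞) (μ : Measure Y) (ν : Measure X)
    [IsProbabilityMeasure μ] [IsProbabilityMeasure ν] :
    wasserstein (graphDist φ f c) (μ.map Sum.inl) (ν.map Sum.inr) ≤
      ∫⁻ y, f y ∂μ + c * totalVariation (μ.map φ) ν := by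
  classical
  obtain ⟨lam, h1, h2, h3⟩ := exists_coupling_le_totalVariation hφ μ ν
  have he : MeasurableEmbedding (Prod.map Sum.inl Sum.inr : Y × X → (Y ⊕ X) × (Y ⊕ X)) :=
    .prodMap
      ⟨Sum.inl_injective, measurable_inl, fun _ hs => measurableSet_inl_image.2 hs⟩
      ⟨Sum.inr_injective, measurable_inr, fun _ hs => measurableSet_inr_image.2 hs⟩
  have hset : MeasurableSet {z : Y × X | φ z.1 ≠ z.2} :=
    (measurableSet_eq_fun (hφ.comp measurable_fst) measurable_snd).compl
  have hD : ∀ z : Y × X, graphDist φ f c (Sum.inl z.1) (Sum.inr z.2) =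
      f z.1 + {z : Y × X | φ z.1 ≠ z.2}.indicator (fun _ => c) z := by
    intro z
    by_cases hz : φ z.1 = z.2 <;> simp [graphDist, hz]
  have hf' : Measurable fun z : Y × X => f z.1 := hf.comp measurable_fst
  refine iInf_le_of_le (lam.map (Prod.map Sum.inl Sum.inr)) (iInf_le_of_le ⟨?_, ?_⟩ ?_)
  · rw [Measure.map_map measurable_fst he.measurable, ← h1,
      Measure.map_map measurable_inl measurable_fst]
    rfl
  · rw [Measure.map_map measurable_snd he.measurable, ← h2,
      Measure.map_map measurable_inr measurable_snd]
    rfl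
  · refine (outerExpectation_map_le he lam _ ?_).trans ?_
    · convert hf'.add (measurable_const (a := c).indicator hset) using 1
      exact funext hD
    · simp only [Prod.map_fst, Prod.map_snd, hD]
      rw [lintegral_add_left hf', lintegral_indicator_const hset, ← h1,
        lintegral_map hf measurable_fst]
      gcongr
      rwa [h1]

end Transport

/-! ### Discounted costs along a chain -/

section Potential

variable {Y : Type*} [MeasurableSpace Y]

/-- The total cost `h` accumulated along the chain with kernel `P` and discount factor `g`. -/
def discountedCost (P : Kernel Y Y) (g : ℝ≥0∞) (h : Y → ℝ≥0∞) (y : Y) : ℝ≥0∞ :=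
  ∑' n : ℕ, g ^ n * (fun f : Y → ℝ≥0∞ => fun y => ∫⁻ z, f z ∂(P y))^[n] h y

theorem measurable_iterate_lintegral (P : Kernel Y Y) {h : Y → ℝ≥0∞} (hh : Measurable h) (n : ℕ) :
    Measurable ((fun f : Y → ℝ≥0∞ => fun y => ∫⁻ z, f z ∂(P y))^[n] h) := by
  induction n with
  | zero => exact hh
  | succ n ih =>
    rw [Function.iterate_succ_apply']
    exact ih.lintegral_kernel

theorem measurable_discountedCost (P : Kernel Y Y) (g : ℝ≥0∞) {h : Y → ℝ≥0∞} (hh : Measurable h) :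
    Measurable (discountedCost P g h) :=
  Measurable.tsum fun n => (measurable_iterate_lintegral P hh n).const_mul _

theorem discountedCost_eq (P : Kernel Y Y) (g : ℝ≥0∞) {h : Y → ℝ≥0∞} (hh : Measurable h) (y : Y) :
    discountedCost P g h y = h y + g * ∫⁻ z, discountedCost P g h z ∂(P y) := by
  have hm := measurable_iterate_lintegral P hh
  unfold discountedCost
  rw [tsum_eq_zero_add' ENNReal.summable,
    lintegral_tsum fun n => ((hm n).const_mul _).aemeasurable, ← ENNReal.tsum_mul_left]
  congr 1
  · simp
  · refine tsum_congr fun n => ?_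
    rw [lintegral_const_mul _ (hm n), Function.iterate_succ_apply', pow_succ']
    ring

/-- By invariance every iterate of `h` has the same mean, which leaves a geometric series. -/
theorem lintegral_discountedCost {P : Kernel Y Y} {ξ : Measure Y} (hξ : P.Invariant ξ) (g : ℝ≥0∞)
    {h : Y → ℝ≥0∞} (hh : Measurable h) :
    ∫⁻ y, discountedCost P g h y ∂ξ = (1 - g)⁻¹ * ∫⁻ y, h y ∂ξ := by
  have hm := measurable_iterate_lintegral P hh
  have hn : ∀ n, ∫⁻ y, (fun f : Y → ℝ≥0∞ => fun y => ∫⁻ z, f z ∂(P y))^[n] h y ∂ξ =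
      ∫⁻ y, h y ∂ξ := by
    intro n
    induction n with
    | zero => rfl
    | succ n ih =>
      rw [Function.iterate_succ_apply', ← ih]
      conv_rhs => rw [← hξ.def]
      rw [Measure.lintegral_bind P.aemeasurable (hm n).aemeasurable]
  unfold discountedCost
  rw [lintegral_tsum fun n => ((hm n).const_mul _).aemeasurable]
  simp_rw [fun n => lintegral_const_mul (μ := ξ) (g ^ n) (hm n), hn]
  rw [ENNReal.tsum_mul_right, ENNReal.tsum_geometric]

end Potential

/-! ### Pre-fixed points that dominate the bisimulation pseudometrics -/

section Comparison

variable {Y X AP : Type*} [MeasurableSpace Y] [MeasurableSpace X] [Countable X]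
  [DiscreteMeasurableSpace X] (C : LabelledChain Y AP) (D : LabelledChain X AP)
  [IsMarkovKernel C.transition] [IsMarkovKernel D.transition] {φ : Y → X}

theorem wasserstein_sum_graphDist_le (hφ : Measurable φ) {f : Y → ℝ≥0∞} (hf : Measurable f)
    (c : ℝ≥0∞) (y : Y) (x : X) :
    wasserstein (graphDist φ f c) ((C.sum D).transition (.inl y)) ((C.sum D).transition (.inr x)) ≤
      ∫⁻ z, f z ∂(C.transition y) +
        c * totalVariation ((C.transition y).map φ) (D.transition x) := by
  have h1 : (C.sum D).transition (.inl y) = (C.transition y).map Sum.inl :=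
    Kernel.map_apply _ measurable_inl _
  have h2 : (C.sum D).transition (.inr x) = (D.transition x).map Sum.inr :=
    Kernel.map_apply _ measurable_inr _
  rw [h1, h2]
  exact wasserstein_graphDist_le hφ hf c _ _

variable {disc : ℝ}

/-- If `φ` maps a chain to a latent chain with one-step errors `r` for rewards and `q` for
transitions, the reward-based bisimulation pseudometric is at most the discounted sum of the
errors. -/
theorem bisimDist_reward_le (hdisc : 0 ≤ disc) (hdisc' : disc < 1) (hφ : Measurable φ)
    {KR KP : ℝ≥0} (hK : disc * KP < 1)
    (hKR : ∀ x x', |D.reward x - D.reward x'| ≤ KR)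
    (hKP : ∀ x x', totalVariation (D.transition x) (D.transition x') ≤ KP)
    {r q : Y → ℝ≥0∞} (hr : Measurable r) (hq : Measurable q)
    (hrew : ∀ y, ENNReal.ofReal |C.reward y - D.reward (φ y)| ≤ r y)
    (htrans : ∀ y, totalVariation ((C.transition y).map φ) (D.transition (φ y)) ≤ q y) (y : Y) :
    bisimDist (C.sum D) disc .reward (.inl y) (.inr (φ y)) ≤
      discountedCost C.transition (ENNReal.ofReal disc) (fun z => ENNReal.ofReal (1 - disc) *
        (r z + ENNReal.ofReal disc * q z * ENNReal.ofReal (KR / (1 - disc * KP)))) y := by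
  set g := ENNReal.ofReal disc with hg
  set g' := ENNReal.ofReal (1 - disc)
  set k := ENNReal.ofReal (KR / (1 - disc * KP)) with hk
  set h : Y → ℝ≥0∞ := fun z => g' * (r z + g * q z * k) with hh
  have mh : Measurable h := (hr.add ((hq.const_mul _).mul_const _)).const_mul _
  have mf : Measurable (discountedCost C.transition g h) := measurable_discountedCost _ _ mh
  -- This equation for `k` is what closes the mismatched case below.
  have hk' : (KR : ℝ≥0∞) + g * (KP * k) = k := by
    have h0 : 0 < 1 - disc * KP := by linarith
    rw [hg, hk, ← ENNReal.ofReal_coe_nnreal, ← ENNReal.ofReal_coe_nnreal (p := KP),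
      ← ENNReal.ofReal_mul KP.coe_nonneg, ← ENNReal.ofReal_mul hdisc,
      ← ENNReal.ofReal_add KR.coe_nonneg (by positivity)]
    congr 1
    field_simp
    ring
  have hmul : ∀ t : ℝ, ENNReal.ofReal ((1 - disc) * t) = g' * ENNReal.ofReal t := fun t =>
    ENNReal.ofReal_mul (by linarith)
  have key : bisimDist (C.sum D) disc .reward ≤
      graphDist φ (discountedCost C.transition g h) (g' * k) := by
    refine OrderHom.lfp_le ⟨_, bisimOp_mono (C.sum D) disc .reward⟩ ?_
    rintro (y | x) (y' | x)
    · exact le_top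
    · have hW := wasserstein_sum_graphDist_le C D hφ mf (g' * k) y x
      simp only [OrderHom.coe_mk, bisimOp, graphDist]
      rw [max_eq_left zero_le, hmul, ← hg]
      refine (add_le_add le_rfl (mul_le_mul_right hW g)).trans ?_
      rw [discountedCost_eq _ _ mh]
      change g' * ENNReal.ofReal |C.reward y - D.reward x| + _ ≤ _
      split_ifs with hyx
      · subst hyx
        calc _ ≤ g' * r y + g * (∫⁻ z, discountedCost C.transition g h z ∂(C.transition y) +
              g' * k * q y) := by gcongr; exacts [hrew y, htrans y]
          _ = _ := by simp only [hh]; ring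
      -- For a mismatched pair, rewards and transitions are compared through `φ y`; the Lipschitz
      -- constants bound the second leg.
      · have h1 : ENNReal.ofReal |C.reward y - D.reward x| ≤ r y + KR := by
          refine (ENNReal.ofReal_le_ofReal (abs_sub_le _ (D.reward (φ y)) _)).trans ?_
          refine ENNReal.ofReal_add_le.trans (add_le_add (hrew y) ?_)
          rw [← ENNReal.ofReal_coe_nnreal]
          exact ENNReal.ofReal_le_ofReal (hKR _ _)
        have h2 : totalVariation ((C.transition y).map φ) (D.transition x) ≤ q y + KP :=
          (totalVariation_triangle _ (D.transition (φ y)) _).trans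
            (add_le_add (htrans y) (hKP _ _))
        calc _ ≤ g' * (r y + KR) + g * (∫⁻ z, discountedCost C.transition g h z ∂(C.transition y) +
              g' * k * (q y + KP)) := by gcongr
          _ = h y + g * ∫⁻ z, discountedCost C.transition g h z ∂(C.transition y) +
              g' * (KR + g * (KP * k)) := by simp only [hh]; ring
          _ = _ := by rw [hk']
    · exact le_top
    · exact le_top
  simpa [graphDist] using key (.inl y) (.inr (φ y))

/-- If `φ` maps a chain to a latent chain and preserves labels, the label-based bisimulation
pseudometric is at most the discounted sum of the one-step errors `q` of the transitions. -/
theorem bisimDist_label_le (hdisc' : disc < 1) (hφ : Measurable φ)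
    (hlabel : ∀ y, C.label y = D.label (φ y)) {q : Y → ℝ≥0∞} (hq : Measurable q)
    (htrans : ∀ y, totalVariation ((C.transition y).map φ) (D.transition (φ y)) ≤ q y) (y : Y) :
    bisimDist (C.sum D) disc .label (.inl y) (.inr (φ y)) ≤
      discountedCost C.transition (ENNReal.ofReal disc) (fun z => ENNReal.ofReal disc * q z) y := by
  set g := ENNReal.ofReal disc with hg
  set h : Y → ℝ≥0∞ := fun z => g * q z with hh
  have mh : Measurable h := hq.const_mul _
  have mf : Measurable (discountedCost C.transition g h) := measurable_discountedCost _ _ mh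
  have hg1 : g ≤ 1 := ENNReal.ofReal_le_one.2 hdisc'.le
  have key : bisimDist (C.sum D) disc .label ≤
      graphDist φ (discountedCost C.transition g h) 1 := by
    refine OrderHom.lfp_le ⟨_, bisimOp_mono (C.sum D) disc .label⟩ ?_
    rintro (y | x) (y' | x)
    · exact le_top
    · have hW := wasserstein_sum_graphDist_le C D hφ mf 1 y x
      simp only [OrderHom.coe_mk, bisimOp, graphDist, zero_add]
      rw [one_mul] at hW
      by_cases hyx : φ y = x
      · have hl : (C.sum D).label (.inl y) = (C.sum D).label (.inr x) := hyx ▸ hlabel y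
        rw [if_pos hl, if_pos hyx, max_eq_left zero_le, add_zero, discountedCost_eq _ _ mh]
        subst hyx
        calc _ ≤ g * (∫⁻ z, discountedCost C.transition g h z ∂(C.transition y) + q y) :=
              mul_le_mul_right (hW.trans (add_le_add le_rfl (htrans y))) g
          _ = _ := by simp only [hh]; ring
      -- The penalty 1 covers a label difference, and also the transition term, where total
      -- variation costs at most `g ≤ 1`. No Lipschitz bound is needed.
      · rw [if_neg hyx]
        refine max_le ?_ (le_trans ?_ le_add_self)
        · rw [discountedCost_eq _ _ mh]
          have : IsProbabilityMeasure ((C.transition y).map φ) :=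
            Measure.isProbabilityMeasure_map hφ.aemeasurable
          calc _ ≤ g * (∫⁻ z, discountedCost C.transition g h z ∂(C.transition y) + 1) :=
                mul_le_mul_right (hW.trans (add_le_add le_rfl (totalVariation_le_one _ _))) g
            _ = g * ∫⁻ z, discountedCost C.transition g h z ∂(C.transition y) + g := by ring
            _ ≤ _ := add_le_add le_add_self hg1
        · split_ifs
          exacts [zero_le, le_rfl]
    · exact le_top
    · exact le_top
  simpa [graphDist] using key (.inl y) (.inr (φ y))

end Comparison

/-! ### One-step errors of the latent space model -/

namespace LatentSpaceModel

variable {S A AP S' A' : Type*} [MeasurableSpace S] [MeasurableSpace A] [MeasurableSpace S']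
  [MeasurableSpace A'] {M : MDP S A AP} {M' : MDP S' A' AP} (L : LatentSpaceModel M M')
  (π : Policy M')

theorem actionKernel_apply (s : S) :
    L.actionKernel π s = (L.latentActionKernel π s).map fun a => L.actionEmb (s, a) := by
  rw [actionKernel, Kernel.map_apply _ L.measurable_actionEmb, Kernel.prod_apply, Kernel.id_apply,
    Measure.dirac_prod, Measure.map_map L.measurable_actionEmb measurable_prodMk_left]
  rfl

theorem chain_transition_apply (s : S) {B : Set S} (hB : MeasurableSet B) :
    (L.chain π).transition s B =
      ∫⁻ a, M.transition (s, L.actionEmb (s, a)) B ∂(L.latentActionKernel π s) := by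
  have := M.isMarkovKernel
  have hm : Measurable fun a => M.transition (s, a) B :=
    (Kernel.measurable_coe _ hB).comp measurable_prodMk_left
  calc _ = ((L.actionKernel π) ⊗ₖ M.transition) s (Prod.snd ⁻¹' B) :=
        Kernel.snd_apply' _ _ hB
    _ = ∫⁻ a, M.transition (s, a) B ∂(L.actionKernel π s) :=
        Kernel.compProd_apply (measurable_snd hB) _ _ _
    _ = _ := by
        have hψ : Measurable fun a => L.actionEmb (s, a) :=
          L.measurable_actionEmb.comp measurable_prodMk_left
        rw [actionKernel_apply, lintegral_map hm hψ]

theorem latentChain_transition_apply (t : S') {B : Set S'} (hB : MeasurableSet B) :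
    (L.latentChain π).transition t B = ∫⁻ a, M'.transition (t, a) B ∂(π.kernel t) := by
  have := M'.isMarkovKernel
  have := π.isMarkovKernel
  exact (Kernel.snd_apply' _ _ hB).trans (Kernel.compProd_apply (measurable_snd hB) _ _ _)

/-- The expected error of the latent reward in a state. -/
def rewardError (s : S) : ℝ≥0∞ :=
  ∫⁻ a, ENNReal.ofReal |M.reward (s, L.actionEmb (s, a)) - M'.reward (L.stateEmb s, a)|
    ∂(L.latentActionKernel π s)

/-- The expected error of the latent transitions in a state. -/
def transitionError (s : S) : ℝ≥0∞ :=
  ∫⁻ a, totalVariation ((M.transition (s, L.actionEmb (s, a))).map L.stateEmb)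
    (M'.transition (L.stateEmb s, a)) ∂(L.latentActionKernel π s)

theorem measurable_rewardError_integrand : Measurable fun p : S × A' =>
    ENNReal.ofReal |M.reward (p.1, L.actionEmb p) - M'.reward (L.stateEmb p.1, p.2)| := by
  have h1 : Measurable fun p : S × A' => M.reward (p.1, L.actionEmb p) :=
    M.measurable_reward.comp (measurable_fst.prodMk L.measurable_actionEmb)
  have h2 : Measurable fun p : S × A' => M'.reward (L.stateEmb p.1, p.2) :=
    M'.measurable_reward.comp
      ((L.measurable_stateEmb.comp measurable_fst).prodMk measurable_snd)
  exact (continuous_abs.measurable.comp (h1.sub h2)).ennreal_ofReal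

theorem measurable_transition_map [DiscreteMeasurableSpace S'] (x : S') :
    Measurable fun p : S × A' => (M.transition (p.1, L.actionEmb p)).map L.stateEmb {x} := by
  simp_rw [Measure.map_apply L.measurable_stateEmb (.of_discrete : MeasurableSet {x})]
  exact (Kernel.measurable_coe _ (L.measurable_stateEmb .of_discrete)).comp
    (measurable_fst.prodMk L.measurable_actionEmb)

theorem measurable_latent_transition [DiscreteMeasurableSpace S'] (x : S') :
    Measurable fun p : S × A' => M'.transition (L.stateEmb p.1, p.2) {x} :=
  (Kernel.measurable_coe _ .of_discrete).comp
    ((L.measurable_stateEmb.comp measurable_fst).prodMk measurable_snd)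

theorem measurable_transitionError_integrand [Countable S'] [DiscreteMeasurableSpace S'] :
    Measurable fun p : S × A' =>
      totalVariation ((M.transition (p.1, L.actionEmb p)).map L.stateEmb)
        (M'.transition (L.stateEmb p.1, p.2)) :=
  Measurable.tsum fun x =>
    (L.measurable_transition_map x).sub (L.measurable_latent_transition x)

theorem measurable_rewardError : Measurable (L.rewardError π) :=
  L.measurable_rewardError_integrand.lintegral_kernel_prod_right'

theorem measurable_transitionError [Countable S'] [DiscreteMeasurableSpace S'] :
    Measurable (L.transitionError π) :=
  L.measurable_transitionError_integrand.lintegral_kernel_prod_right'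

theorem lintegral_rewardError (ξ : Measure S) [SFinite ξ] :
    ∫⁻ s, L.rewardError π s ∂ξ = L.localRewardLoss (L.stateActionLaw π ξ) :=
  (Measure.lintegral_compProd L.measurable_rewardError_integrand).symm

/-- The Wasserstein integrand of the loss is not known to be measurable, but its integral still
dominates that of the measurable total variation below it. -/
theorem lintegral_transitionError_le [Countable S'] [DiscreteMeasurableSpace S'] (ξ : Measure S)
    [SFinite ξ] :
    ∫⁻ s, L.transitionError π s ∂ξ ≤ L.localTransitionLoss (L.stateActionLaw π ξ) :=
  (Measure.lintegral_compProd L.measurable_transitionError_integrand).symm.le.trans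
    (lintegral_mono fun _ => totalVariation_le_wasserstein _ _)

/-- Averages over the same latent action are compared under the integral sign. Both rewards must be
integrable for the difference of integrals to be the integral of the difference. -/
theorem ofReal_abs_reward_sub_le {B : ℝ} (hB : ∀ p, |M.reward p| ≤ B) (s : S)
    (hint : Integrable (fun a => M'.reward (L.stateEmb s, a)) (π.kernel (L.stateEmb s))) :
    ENNReal.ofReal |(L.chain π).reward s - (L.latentChain π).reward (L.stateEmb s)| ≤
      L.rewardError π s := by
  have hψ : Measurable fun a => L.actionEmb (s, a) :=
    L.measurable_actionEmb.comp measurable_prodMk_left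
  have hR : Measurable fun a => M.reward (s, a) := M.measurable_reward.comp measurable_prodMk_left
  have h1 : (L.chain π).reward s =
      ∫ a, M.reward (s, L.actionEmb (s, a)) ∂(L.latentActionKernel π s) := by
    change ∫ a, M.reward (s, a) ∂(L.actionKernel π s) = _
    rw [actionKernel_apply, integral_map hψ.aemeasurable hR.aestronglyMeasurable]
  have h2 : (L.latentChain π).reward (L.stateEmb s) =
      ∫ a, M'.reward (L.stateEmb s, a) ∂(L.latentActionKernel π s) := rfl
  have hi : Integrable (fun a => M.reward (s, L.actionEmb (s, a))) (L.latentActionKernel π s) :=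
    Integrable.of_bound (hR.comp hψ).aestronglyMeasurable B (.of_forall fun _ => hB _)
  rw [h1, h2, ← integral_sub hi hint, ← Real.enorm_eq_ofReal_abs]
  refine (enorm_integral_le_lintegral_enorm _).trans (le_of_eq ?_)
  simp only [Real.enorm_eq_ofReal_abs, rewardError]

/-- Joint convexity of total variation: at each point, the truncated difference of the averages is
at most the average of the truncated differences. -/
theorem totalVariation_transition_le [Countable S'] [DiscreteMeasurableSpace S'] (s : S) :
    totalVariation (((L.chain π).transition s).map L.stateEmb)
      ((L.latentChain π).transition (L.stateEmb s)) ≤ L.transitionError π s := by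
  have m1 : ∀ x, Measurable fun a =>
      (M.transition (s, L.actionEmb (s, a))).map L.stateEmb {x} := fun x =>
    (L.measurable_transition_map x).comp measurable_prodMk_left
  have m2 : ∀ x, Measurable fun a => M'.transition (L.stateEmb s, a) {x} := fun x =>
    (L.measurable_latent_transition x).comp measurable_prodMk_left
  have m3 : ∀ x, Measurable fun a => (M.transition (s, L.actionEmb (s, a))).map L.stateEmb {x} -
      M'.transition (L.stateEmb s, a) {x} := fun x => (m1 x).sub (m2 x)
  unfold totalVariation transitionError totalVariation
  rw [lintegral_tsum fun x => (m3 x).aemeasurable]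
  refine ENNReal.tsum_le_tsum fun x => le_trans (le_of_eq ?_) (lintegral_sub_le _ _ (m2 x))
  have hx : MeasurableSet {x} := .of_discrete
  rw [Measure.map_apply L.measurable_stateEmb hx,
    L.chain_transition_apply π s (L.measurable_stateEmb hx),
    L.latentChain_transition_apply π _ hx]
  simp only [Measure.map_apply L.measurable_stateEmb hx]
  rfl

end LatentSpaceModel

end LatentMDP

end

/-! ### Averaging over the stationary law -/

theorem mainTheorem3 {S A AP S' A' : Type*}
    [MeasurableSpace S] [StandardBorelSpace S] [MeasurableSpace A] [StandardBorelSpace A]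
    [MeasurableSpace S'] [Countable S'] [DiscreteMeasurableSpace S']
    [MeasurableSpace A'] [StandardBorelSpace A']
    (M : LatentMDP.MDP S A AP) (M' : LatentMDP.MDP S' A' AP)
    (L : LatentMDP.LatentSpaceModel M M') (π : LatentMDP.Policy M')
    (disc : ℝ) (hdisc : 0 ≤ disc) (hdisc' : disc < 1)
    (hreward : ∀ p, M.reward p ∈ Set.Icc (-1 / 2 : ℝ) (1 / 2))
    (hlabel : ∀ s, M.label s = M'.label (L.stateEmb s))
    (hint : ∀ t, Integrable (fun a => M'.reward (t, a)) (π.kernel t))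
    (KR KP : ℝ≥0) (hLip : L.IsLipschitz π KR KP)
    (ξ : Measure S) (hξ : L.IsStationary π ξ) :
    (disc * KP < 1 →
      LatentMDP.outerExpectation ξ
          (fun s => L.dist π disc .reward (Sum.inl s) (Sum.inr (L.stateEmb s))) ≤
        L.localRewardLoss (L.stateActionLaw π ξ) +
          ENNReal.ofReal disc * L.localTransitionLoss (L.stateActionLaw π ξ) *
            ENNReal.ofReal (KR / (1 - disc * KP))) ∧
    LatentMDP.outerExpectation ξ
        (fun s => L.dist π disc .label (Sum.inl s) (Sum.inr (L.stateEmb s))) ≤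
      ENNReal.ofReal disc * L.localTransitionLoss (L.stateActionLaw π ξ) /
        ENNReal.ofReal (1 - disc) := by
  obtain ⟨hprob, hinv⟩ := hξ
  have hr := L.measurable_rewardError π
  have hq := L.measurable_transitionError π
  have hsub : 1 - ENNReal.ofReal disc = ENNReal.ofReal (1 - disc) := by
    rw [ENNReal.ofReal_sub _ hdisc, ENNReal.ofReal_one]
  have hqle := L.lintegral_transitionError_le π ξ
  refine ⟨fun hK => ?_, ?_⟩
  · have hKR : ∀ x x', |(L.latentChain π).reward x - (L.latentChain π).reward x'| ≤ KR :=
      fun x x' => (hLip.1 x x').trans <| by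
        by_cases h : x = x' <;> simp [LatentMDP.discreteMetric, h]
    have hKP : ∀ x x', LatentMDP.totalVariation ((L.latentChain π).transition x)
        ((L.latentChain π).transition x') ≤ KP := fun x x' =>
      (LatentMDP.totalVariation_le_wasserstein _ _).trans <| (hLip.2 x x').trans <| by
        by_cases h : x = x' <;> simp [LatentMDP.discreteMetric, h]
    have hB : ∀ p, |M.reward p| ≤ 1 / 2 := fun p =>
      abs_le.2 ⟨by linarith [(hreward p).1], (hreward p).2⟩
    have ms : Measurable fun s => L.rewardError π s +
        ENNReal.ofReal disc * L.transitionError π s * ENNReal.ofReal (KR / (1 - disc * KP)) :=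
      hr.add ((hq.const_mul _).mul_const _)
    have mh := ms.const_mul (ENNReal.ofReal (1 - disc))
    -- The discounted cost serves as the measurable majorant in the outer expectation.
    refine iInf_le_of_le _ (iInf_le_of_le (LatentMDP.measurable_discountedCost
      (L.chain π).transition _ mh) (iInf_le_of_le (fun s => LatentMDP.bisimDist_reward_le
        (L.chain π) (L.latentChain π) hdisc hdisc' L.measurable_stateEmb hK hKR hKP hr hq
        (fun s => L.ofReal_abs_reward_sub_le π hB s (hint _))
        (L.totalVariation_transition_le π) s) ?_))
    -- The factor `1 - γ` carried by the reward cost cancels the geometric sum; the label cost has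
    -- no such factor, hence the denominator in the second bound.
    rw [LatentMDP.lintegral_discountedCost hinv _ mh, hsub,
      lintegral_const_mul _ ms, ← mul_assoc,
      ENNReal.inv_mul_cancel (by simpa using hdisc') ENNReal.ofReal_ne_top, one_mul,
      lintegral_add_left hr, lintegral_mul_const _ (hq.const_mul _), lintegral_const_mul _ hq,
      L.lintegral_rewardError π ξ]
    gcongr
  · have mh : Measurable fun s => ENNReal.ofReal disc * L.transitionError π s := hq.const_mul _
    refine iInf_le_of_le _ (iInf_le_of_le (LatentMDP.measurable_discountedCost
      (L.chain π).transition _ mh) (iInf_le_of_le (fun s => LatentMDP.bisimDist_label_le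
        (L.chain π) (L.latentChain π) hdisc' L.measurable_stateEmb hlabel hq
        (L.totalVariation_transition_le π) s) ?_))
    rw [LatentMDP.lintegral_discountedCost hinv _ mh, hsub, lintegral_const_mul _ hq, mul_comm,
      ← div_eq_mul_inv]
    gcongr
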